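/- Let $n,m$ be positive integers. For a finite set $S$ of pairs of nonnegative integers let $\langle S\rangle$ be the complex span of the monomials $z^jw^k$, $(j,k)\in S$, and put $$G=\langle 0\le j\le n,\,0\le k\le m\rangle,\qquad G^{LL}=\langle 0\le j\le n,\,0\le k\le m,\,(j,k)\ne(0,0)\rangle,$$ $$G^{UR}=\langle 0\le j\le n,\,0\le k\le m,\,(j,k)\neq(n,m)\rangle,\qquad G^{R}=\langle 0\le j\le n-1,\,0\le k\le m\rangle,$$ $$G^{U}=\langle 0\le j\le n,\,0\le k\le m-1\rangle,\qquad G^{S}=\langle 0\le j\le n-1,\,0\le k\le m-1\rangle .$$ For a finite Borel measure $\sigma$ on $\mathbb T^2$ put $\langle P,Q\rangle_\sigma=\int_{\mathbb T^2}P\overline Q\,d\sigma$ and $\|P\|_\sigma=\langle P,P\rangle_\sigma^{1/2}$ for polynomials $P,Q$ in $z,w$. For spaces $V,W$ of polynomials let $V\ominus_\sigma W=\{P\in V:\langle P,Q\rangle_\sigma=0\text{ for all }Q\in W\}$. If $V$ is finite dimensional and $\|\cdot\|_\sigma$ is a norm on $V$, let $K_\sigma V:\mathbb C^2\times\mathbb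 C^2\to\mathbb C$ be the reproducing kernel of $V$: for each $y\in\mathbb C^2$, $K_\sigma V(\cdot,y)$ is the unique element of $V$ with $\langle P,K_\sigma V(\cdot,y)\rangle_\sigma=P(y)$ for all $P\in V$. Let $\rho$ be a Borel probability measure on $\mathbb T^2$ that is nondegenerate, i.e. $P\in G$ and $\|P\|_\rho=0$ imply $P=0$. Let $p$ be a polynomial with $\|p\|_\rho=1$ and $$K_\rho(G\ominus_\rho G^{LL})(x,y)=p(x)\overline{p(y)}\qquad(x,y\in\mathbb C^2)$$ (such a $p$ exists and is unique up to a unimodular constant). Suppose that $p$ is stable, i.e. has no zeros in $\overline{\mathbb D}^2$, and that the measure $$d\mu=\frac{1}{(2\pi i)^2|p(z,w)|^2}\frac{dz}{z}\frac{dw}{w}$$ on $\mathbb T^2$ satisfies $K_\mu G=K_\rho G$. Then $$G^{UR}\ominus_\rho G^{R}=G^{U}\ominus_\rho G^{S}.$$ -/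

import Mathlib

open MeasureTheory

namespace TorusPoly

noncomputable section

/-- Holomorphic polynomials in the two complex variables `z` (index `0`) and `w` (index `1`). -/
abbrev Poly : Type := MvPolynomial (Fin 2) ℂ

/-- The Borel `σ`-algebra on the unit circle. -/
instance circleMeasurableSpace : MeasurableSpace Circle := borel Circle

instance circleBorelSpace : BorelSpace Circle := ⟨rfl⟩

/-- The 2-torus `𝕋²`. -/
abbrev Torus : Type := Circle × Circle

/-- A point of the torus as a point of `ℂ²`. -/
def toC2 (t : Torus) : ℂ × ℂ := ((t.1 : ℂ), (t.2 : ℂ))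

/-- The value `P(z, w)` at a point `a = (z, w)` of `ℂ²`. -/
def value (P : Poly) (a : ℂ × ℂ) : ℂ := MvPolynomial.eval ![a.1, a.2] P

/-- The inner product `⟨P, Q⟩_ρ = ∫ P * conj Q dρ`, linear in the first argument. -/
def ip (ρ : Measure Torus) (P Q : Poly) : ℂ :=
  ∫ t, value P (toC2 t) * starRingEnd ℂ (value Q (toC2 t)) ∂ρ

/-- The norm `‖P‖_ρ = √⟨P, P⟩_ρ`. -/
def pnorm (ρ : Measure Torus) (P : Poly) : ℝ := Real.sqrt (ip ρ P P).re

/-- The span of the monomials `z ^ j * w ^ k` with `(j, k) ∈ S`. -/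
def monomialSpan (S : Set (ℕ × ℕ)) : Submodule ℂ Poly :=
  Submodule.span ℂ
    ((fun jk : ℕ × ℕ => (MvPolynomial.X 0 ^ jk.1 * MvPolynomial.X 1 ^ jk.2 : Poly)) '' S)

/-- Polynomials of degree `(n, m)`. -/
def box (n m : ℕ) : Submodule ℂ Poly := monomialSpan {jk | jk.1 ≤ n ∧ jk.2 ≤ m}

/-- The box with its upper right corner `z ^ n * w ^ m` removed. -/
def boxUR (n m : ℕ) : Submodule ℂ Poly :=
  monomialSpan {jk | jk.1 ≤ n ∧ jk.2 ≤ m ∧ jk ≠ (n, m)}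

/-- The box with its lower left corner `1` removed. -/
def boxLL (n m : ℕ) : Submodule ℂ Poly :=
  monomialSpan {jk | jk.1 ≤ n ∧ jk.2 ≤ m ∧ jk ≠ (0, 0)}

/-- The box with its upper edge removed: `0 ≤ j ≤ n`, `0 ≤ k ≤ m - 1`. -/
def boxU (n m : ℕ) : Submodule ℂ Poly := monomialSpan {jk | jk.1 ≤ n ∧ jk.2 < m}

/-- The box with its right edge removed: `0 ≤ j ≤ n - 1`, `0 ≤ k ≤ m`. -/
def boxR (n m : ℕ) : Submodule ℂ Poly := monomialSpan {jk | jk.1 < n ∧ jk.2 ≤ m}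

/-- The small box: `0 ≤ j ≤ n - 1`, `0 ≤ k ≤ m - 1`. -/
def boxSM (n m : ℕ) : Submodule ℂ Poly := monomialSpan {jk | jk.1 < n ∧ jk.2 < m}

theorem finiteDimensional_box (n m : ℕ) : FiniteDimensional ℂ (box n m) := by
  have hS : {jk : ℕ × ℕ | jk.1 ≤ n ∧ jk.2 ≤ m}.Finite :=
    ((Set.finite_Iic n).prod (Set.finite_Iic m)).subset fun jk h => h
  exact FiniteDimensional.span_of_finite ℂ (hS.image _)

theorem continuous_value (P : Poly) : Continuous fun t : Torus => value P (toC2 t) := by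
  unfold value toC2
  have h : Continuous fun t : Torus => (![(t.1 : ℂ), (t.2 : ℂ)] : Fin 2 → ℂ) := by
    refine continuous_pi fun i => ?_
    fin_cases i
    · exact continuous_subtype_val.comp continuous_fst
    · exact continuous_subtype_val.comp continuous_snd
  exact (MvPolynomial.continuous_eval P).comp h

theorem integrable_ip (ρ : Measure Torus) [IsFiniteMeasure ρ] (P Q : Poly) :
    Integrable (fun t => value P (toC2 t) * starRingEnd ℂ (value Q (toC2 t))) ρ := by
  have hc : Continuous fun t : Torus => value P (toC2 t) * starRingEnd ℂ (value Q (toC2 t)) :=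
    (continuous_value P).mul (Complex.continuous_conj.comp (continuous_value Q))
  exact (BoundedContinuousFunction.mkOfCompact ⟨_, hc⟩).integrable ρ

theorem ip_add_left (ρ : Measure Torus) [IsFiniteMeasure ρ] (P P' Q : Poly) :
    ip ρ (P + P') Q = ip ρ P Q + ip ρ P' Q := by
  unfold ip
  rw [← integral_add (integrable_ip ρ P Q) (integrable_ip ρ P' Q)]
  simp [value, add_mul]

theorem ip_smul_left (ρ : Measure Torus) (c : ℂ) (P Q : Poly) :
    ip ρ (c • P) Q = c * ip ρ P Q := by
  unfold ip
  rw [← integral_const_mul]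
  simp [value, mul_assoc, MvPolynomial.smul_eval]

theorem ip_conj (ρ : Measure Torus) (P Q : Poly) :
    starRingEnd ℂ (ip ρ Q P) = ip ρ P Q := by
  unfold ip
  rw [← integral_conj]
  simp [mul_comm]

theorem ip_self (ρ : Measure Torus) (P : Poly) :
    ip ρ P P = ((∫ t, ‖value P (toC2 t)‖ ^ 2 ∂ρ : ℝ) : ℂ) := by
  unfold ip
  rw [← integral_complex_ofReal]
  simp [Complex.mul_conj, Complex.normSq_eq_norm_sq]

/-- `V ⊖_ρ W`: the elements of `V` that are `ρ`-orthogonal to all of `W`. -/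
def ominus (ρ : Measure Torus) [IsFiniteMeasure ρ] (V W : Submodule ℂ Poly) :
    Submodule ℂ Poly where
  carrier := {P | P ∈ V ∧ ∀ Q ∈ W, ip ρ P Q = 0}
  add_mem' := by
    rintro P P' ⟨hP, hP0⟩ ⟨hP', hP0'⟩
    exact ⟨V.add_mem hP hP', fun Q hQ => by rw [ip_add_left, hP0 Q hQ, hP0' Q hQ, add_zero]⟩
  zero_mem' := ⟨V.zero_mem, fun Q _ => by simp [ip, value]⟩
  smul_mem' := by
    rintro c P ⟨hP, hP0⟩
    exact ⟨V.smul_mem c hP, fun Q hQ => by rw [ip_smul_left, hP0 Q hQ, mul_zero]⟩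

/-- `ρ` is nondegenerate at the `(n, m)` level. -/
def Nondegenerate (ρ : Measure Torus) (n m : ℕ) : Prop :=
  ∀ P ∈ box n m, pnorm ρ P = 0 → P = 0

/-- `K` is the element of `V` representing evaluation at `y` in the `ρ`-inner product. -/
def Represents (ρ : Measure Torus) (V : Submodule ℂ Poly) (y : ℂ × ℂ) (K : Poly) : Prop :=
  K ∈ V ∧ ∀ P ∈ V, ip ρ P K = value P y

theorem exists_riesz {E : Type*} [AddCommGroup E] [Module ℂ E] [FiniteDimensional ℂ E]
    (core : InnerProductSpace.Core ℂ E) (f : E →ₗ[ℂ] ℂ) :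
    ∃ K : E, ∀ P : E, core.inner K P = f P := by
  let _ : NormedAddCommGroup E := core.toNormedAddCommGroup
  let _ : InnerProductSpace ℂ E := InnerProductSpace.ofCore core.toCore
  have : CompleteSpace E := FiniteDimensional.complete ℂ E
  exact ⟨(InnerProductSpace.toDual ℂ E).symm (LinearMap.toContinuousLinearMap f), fun P =>
    InnerProductSpace.toDual_symm_apply⟩

/-- If `ρ` is positive definite on the finite dimensional space `V`, then evaluation at `y` is
represented by one and only one element of `V`. -/
theorem existsUnique_represents (ρ : Measure Torus) [IsFiniteMeasure ρ]
    (V : Submodule ℂ Poly) [FiniteDimensional ℂ V]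
    (hV : ∀ P ∈ V, pnorm ρ P = 0 → P = 0) (y : ℂ × ℂ) :
    ∃! K : Poly, Represents ρ V y K := by
  have hself : ∀ P : Poly, 0 ≤ (ip ρ P P).re := fun P => by
    rw [ip_self, Complex.ofReal_re]
    exact integral_nonneg fun t => by positivity
  have hdef : ∀ P ∈ V, ip ρ P P = 0 → P = 0 := fun P hP h => hV P hP (by simp [pnorm, h])
  let core : InnerProductSpace.Core ℂ V :=
    { inner := fun P Q => ip ρ Q P
      conj_inner_symm := fun P Q => ip_conj ρ _ _
      re_inner_nonneg := fun P => hself P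
      add_left := fun P P' Q => by
        rw [← ip_conj ρ (Q : Poly) _, ← ip_conj ρ (Q : Poly) P, ← ip_conj ρ (Q : Poly) P',
          ← map_add, ← ip_add_left]
        rfl
      smul_left := fun P Q c => by
        rw [← ip_conj ρ _ (P : Poly), ← map_mul, ← ip_smul_left, ip_conj]
        rfl
      definite := fun P h => Subtype.ext (hdef P P.2 h) }
  let ev : V →ₗ[ℂ] ℂ :=
    { toFun := fun P => value P y
      map_add' := fun P Q => by simp [value]
      map_smul' := fun c P => by simp [value, MvPolynomial.smul_eval] }
  obtain ⟨K, hK0⟩ := exists_riesz core ev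
  have hK : ∀ P ∈ V, ip ρ P K = value P y := fun P hP => hK0 ⟨P, hP⟩
  refine ⟨K, ⟨K.2, hK⟩, ?_⟩
  rintro K' ⟨hK'mem, hK'⟩
  have hd : K' - (K : Poly) ∈ V := V.sub_mem hK'mem K.2
  refine sub_eq_zero.1 (hdef _ hd ?_)
  have e : K' - (K : Poly) = K' + (-1 : ℂ) • (K : Poly) := by simp [sub_eq_add_neg]
  rw [← ip_conj]
  nth_rewrite 1 [e]
  rw [ip_add_left, ip_smul_left, ← ip_conj ρ K', ← ip_conj ρ (K : Poly), hK' _ hd, hK _ hd]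
  simp

open Classical in
/-- `K_ρ V_y`: the representing element of evaluation at `y` on `V` (it exists and is unique
when `ρ` is positive definite on `V`, by `existsUnique_represents`). -/
def kernelAt (ρ : Measure Torus) (V : Submodule ℂ Poly) (y : ℂ × ℂ) : Poly :=
  if h : ∃ K : Poly, Represents ρ V y K then h.choose else 0

/-- The reproducing kernel `K_ρ V : ℂ² × ℂ² → ℂ`, `K_ρ V (x, y) = K_ρ V_y (x)`. -/
def kernel (ρ : Measure Torus) (V : Submodule ℂ Poly) (x y : ℂ × ℂ) : ℂ :=
  value (kernelAt ρ V y) x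

theorem kernelAt_represents (ρ : Measure Torus) [IsFiniteMeasure ρ]
    (V : Submodule ℂ Poly) [FiniteDimensional ℂ V]
    (hV : ∀ P ∈ V, pnorm ρ P = 0 → P = 0) (y : ℂ × ℂ) :
    Represents ρ V y (kernelAt ρ V y) := by
  have h : ∃ K : Poly, Represents ρ V y K := (existsUnique_represents ρ V hV y).exists
  rw [kernelAt, dif_pos h]
  exact h.choose_spec

theorem kernelAt_box_represents (ρ : Measure Torus) [IsFiniteMeasure ρ] (n m : ℕ)
    (hρ : Nondegenerate ρ n m) (y : ℂ × ℂ) :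
    Represents ρ (box n m) y (kernelAt ρ (box n m) y) := by
  have := finiteDimensional_box n m
  exact kernelAt_represents ρ (box n m) hρ y

theorem kernelAt_ominus_represents (ρ : Measure Torus) [IsFiniteMeasure ρ] (n m : ℕ)
    (hρ : Nondegenerate ρ n m) (W : Submodule ℂ Poly) (y : ℂ × ℂ) :
    Represents ρ (ominus ρ (box n m) W) y (kernelAt ρ (ominus ρ (box n m) W) y) := by
  have := finiteDimensional_box n m
  have hle : ominus ρ (box n m) W ≤ box n m := fun P hP => hP.1
  have : FiniteDimensional ℂ (ominus ρ (box n m) W) := Submodule.finiteDimensional_of_le hle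
  exact kernelAt_represents ρ _ (fun P hP h => hρ P (hle hP) h) y

/-- Stability: no zeros in the closed bidisk. -/
def Stable (P : Poly) : Prop :=
  ∀ z w : ℂ, ‖z‖ ≤ 1 → ‖w‖ ≤ 1 → value P (z, w) ≠ 0

/-- Normalized Lebesgue measure `(1 / 2πi) dz / z` on the unit circle: the law of `exp (iθ)` for
`θ` uniform on `(0, 2π]`. -/
def circleLebesgue : Measure Circle :=
  Measure.map Circle.exp
    ((ENNReal.ofReal (2 * Real.pi))⁻¹ • volume.restrict (Set.Ioc 0 (2 * Real.pi)))

instance circleLebesgue_isProbabilityMeasure : IsProbabilityMeasure circleLebesgue := by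
  refine ⟨?_⟩
  have hpi : 0 < 2 * Real.pi := by positivity
  rw [circleLebesgue, Measure.map_apply Circle.exp.continuous.measurable MeasurableSet.univ]
  simp only [Set.preimage_univ, Measure.smul_apply, Measure.restrict_apply_univ, smul_eq_mul,
    Real.volume_Ioc, sub_zero]
  exact ENNReal.inv_mul_cancel (by simpa using hpi) ENNReal.ofReal_ne_top

/-- The measure `(1 / (2πi)²) |p(z, w)|⁻² (dz / z) (dw / w)` on the torus. -/
def bernsteinSzego (p : Poly) : Measure Torus :=
  (circleLebesgue.prod circleLebesgue).withDensity
    fun t => ENNReal.ofReal (1 / ‖value p (toC2 t)‖ ^ 2)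

/-- `p` is a polynomial of unit norm with `K_ρ (box ⊖ boxLL) = p * conj p`; such a `p` is
determined by `ρ` up to a unimodular constant. -/
def IsKernelPolynomial (ρ : Measure Torus) [IsFiniteMeasure ρ] (n m : ℕ) (p : Poly) : Prop :=
  pnorm ρ p = 1 ∧
    ∀ x y : ℂ × ℂ, kernel ρ (ominus ρ (box n m) (boxLL n m)) x y =
      value p x * starRingEnd ℂ (value p y)

end

end TorusPoly

/-! Reproducing kernels determine inner products (`ip_eq_of_kernel_eq`), so on the full box ρ may be
replaced by the measure with density |R|², R = 1/p. Stability makes R holomorphic near the disk in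
each variable, hence ∫ z^j w^k R = 0 as soon as j > 0 or k > 0 (`Stable.hasMoments_inv`).

Let f in G^{UR} be orthogonal to G^R. The core is that f is then orthogonal to z^j w^k for every j <
n, negative j included, with 0 ≤ k ≤ m (`moment_eq_zero_of_neg`). On the strip 0 ≤ k ≤ m the
monomials have an explicit biorthogonal family with z-bandwidth n (`wip_mono_dual`, `dual_mem`): the
inverse of the Gram matrix is banded. This bounds the sum of squares of the moments in the columns
-(N+n), …, -1 by a constant times its part in the n outermost columns (`sum_sq_moments_le`). The
partial sums are bounded, so these outer parts tend to 0 and all the moments vanish.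

Multiples of conj p can now be tested against f. Together with the absence of z^n w^m from f, this
kills the coefficients of w^m (`lcoeff_top_eq_zero`), so f lies in G^U. The reverse inclusion
follows by projecting onto G^R, using G^U ∩ G^R = G^S. -/

namespace TorusPoly

noncomputable section

/-! ### Laurent monomials and integration on the torus -/

/-- Continuous functions on the torus. -/
abbrev CT : Type := C(Torus, ℂ)

/-- Normalized Lebesgue measure on the torus. -/
abbrev torusLebesgue : Measure Torus := circleLebesgue.prod circleLebesgue

/-- The Laurent monomial `z ^ s.1 * w ^ s.2` on the torus. -/
def mono (s : ℤ × ℤ) : CT :=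
  ⟨fun t => ((t.1 ^ s.1 * t.2 ^ s.2 : Circle) : ℂ), by
    have h : Continuous fun t : Torus => t.1 ^ s.1 * t.2 ^ s.2 :=
      (continuous_fst.zpow s.1).mul (continuous_snd.zpow s.2)
    exact Continuous.comp (g := fun z : Circle => (z : ℂ)) continuous_subtype_val h⟩

theorem mono_apply (s : ℤ × ℤ) (t : Torus) :
    mono s t = (t.1 : ℂ) ^ s.1 * (t.2 : ℂ) ^ s.2 := by
  simp [mono]

theorem mono_add (s t : ℤ × ℤ) : mono (s + t) = mono s * mono t := by
  ext x
  simp only [mono, ContinuousMap.coe_mk, ContinuousMap.mul_apply, Prod.fst_add, Prod.snd_add,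
    zpow_add, Circle.coe_mul]
  ring

theorem mono_zero : mono 0 = 1 := by
  ext x
  simp [mono]

theorem star_mono (s : ℤ × ℤ) : star (mono s) = mono (-s) := by
  ext x
  simp only [mono, ContinuousMap.coe_mk, ContinuousMap.star_apply, Prod.fst_neg, Prod.snd_neg,
    zpow_neg, ← mul_inv]
  rw [Circle.coe_inv_eq_conj]
  rfl

theorem integrable_torus (f : CT) : Integrable f torusLebesgue :=
  (BoundedContinuousFunction.mkOfCompact f).integrable _

/-- Integration over the torus, as a linear functional. -/
def tint : CT →ₗ[ℂ] ℂ where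
  toFun := fun f => ∫ t, f t ∂torusLebesgue
  map_add' f g := integral_add (integrable_torus f) (integrable_torus g)
  map_smul' := fun c _ => integral_const_mul c _

theorem tint_apply (f : CT) : tint f = ∫ t, f t ∂torusLebesgue := rfl

theorem tint_star (f : CT) : tint (star f) = starRingEnd ℂ (tint f) :=
  integral_conj

theorem integral_circleLebesgue (f : ℂ → ℂ) (hf : Continuous fun z : Circle => f z) :
    ∫ z : Circle, f z ∂circleLebesgue = Real.circleAverage f 0 1 := by
  rw [circleLebesgue, integral_map Circle.exp.continuous.measurable.aemeasurable
    hf.aestronglyMeasurable, integral_smul_measure, Real.circleAverage_def,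
    intervalIntegral.integral_of_le (by positivity), ENNReal.toReal_inv,
    ENNReal.toReal_ofReal (by positivity)]
  simp [circleMap, Circle.coe_exp]

/-- Mean value property: the average is the value of z^k g at the centre, which is 0 because k > 0.
-/
theorem integral_circle_pow_mul (g : ℂ → ℂ) (k : ℕ) (hk : 0 < k)
    (hg : DiffContOnCl ℂ g (Metric.ball 0 1)) (hc : Continuous fun z : Circle => g z) :
    ∫ z : Circle, (z : ℂ) ^ k * g z ∂circleLebesgue = 0 := by
  rw [integral_circleLebesgue (fun z => z ^ k * g z)
    ((continuous_subtype_val.pow k).mul hc)]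
  have h : DiffContOnCl ℂ (fun z => z ^ k • g z) (Metric.ball 0 |1|) := by
    rw [abs_one]
    exact (differentiable_id.pow k).diffContOnCl.smul hg
  have := h.circleAverage
  simpa [hk.ne'] using this

/-- A function with values `g z w` on the torus, holomorphic in each variable on the disk,
has vanishing moments. -/
theorem tint_mono_mul_eq_zero (R : CT) (g : ℂ → ℂ → ℂ) (hR : ∀ t : Torus, R t = g t.1 t.2)
    (h1 : ∀ w : Circle, DiffContOnCl ℂ (fun z => g z w) (Metric.ball 0 1))
    (h2 : ∀ z : Circle, DiffContOnCl ℂ (fun w => g z w) (Metric.ball 0 1))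
    (s : ℤ × ℤ) (hs : 0 < s.1 ∨ 0 < s.2) : tint (mono s * R) = 0 := by
  have hint := integrable_torus (mono s * R)
  obtain ⟨j, k⟩ := s
  rw [tint_apply]
  -- Integrate first in a variable whose exponent is positive. The other exponent may have any sign,
  -- since its monomial is then a constant factor.
  rcases hs with hs | hs
  · rw [integral_prod_symm _ hint]
    rw [← integral_zero Circle ℂ (μ := circleLebesgue)]
    congr 1
    ext w
    lift j to ℕ using hs.le
    have hc : Continuous fun z : Circle => g z w := 
      (R.continuous.comp (Continuous.prodMk_left w)).congr fun z => hR (z, w)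
    have := integral_circle_pow_mul (fun z => g z w) j (by simpa using hs) (h1 w) hc
    simp only [ContinuousMap.mul_apply, mono_apply, hR, zpow_natCast]
    rw [← mul_zero ((w : ℂ) ^ k), ← this, ← integral_const_mul]
    congr 1
    ext z
    ring
  · rw [integral_prod _ hint]
    rw [← integral_zero Circle ℂ (μ := circleLebesgue)]
    congr 1
    ext z
    lift k to ℕ using hs.le
    have hc : Continuous fun w : Circle => g z w := 
      (R.continuous.comp (Continuous.prodMk_right z)).congr fun w => hR (z, w)
    have := integral_circle_pow_mul (fun w => g z w) k (by simpa using hs) (h2 z) hc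
    simp only [ContinuousMap.mul_apply, mono_apply, hR, zpow_natCast]
    rw [← mul_zero ((z : ℂ) ^ j), ← this, ← integral_const_mul]
    congr 1
    ext w
    ring

theorem tint_mono_of_pos {s : ℤ × ℤ} (hs : 0 < s.1 ∨ 0 < s.2) : tint (mono s) = 0 := by
  have := tint_mono_mul_eq_zero 1 (fun _ _ => 1) (fun _ => rfl)
    (fun _ => diffContOnCl_const) (fun _ => diffContOnCl_const) s hs
  rwa [mul_one] at this

theorem tint_one : tint 1 = 1 := by
  simp [tint_apply]

theorem tint_mono (s : ℤ × ℤ) : tint (mono s) = if s = 0 then 1 else 0 := by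
  split_ifs with h
  · rw [h, mono_zero, tint_one]
  · by_cases hs : 0 < s.1 ∨ 0 < s.2
    · exact tint_mono_of_pos hs
    · have hs' : 0 < (-s).1 ∨ 0 < (-s).2 := by
        have : ¬ (s.1 = 0 ∧ s.2 = 0) := fun h' => h (Prod.ext h'.1 h'.2)
        simp only [Prod.fst_neg, Prod.snd_neg]
        omega
      have h0 := tint_mono_of_pos hs'
      rw [← star_mono, tint_star, map_eq_zero] at h0
      exact h0

/-! ### The inner product with weight |R|² -/

/-- The class in `L²` of the function `x * R`. -/
def toL2 (R : CT) : CT →ₗ[ℂ] Lp ℂ 2 torusLebesgue :=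
  (ContinuousMap.toLp 2 torusLebesgue ℂ : CT →L[ℂ] Lp ℂ 2 torusLebesgue).toLinearMap ∘ₗ
    LinearMap.mulRight ℂ R

theorem toL2_apply (R x : CT) : toL2 R x = ContinuousMap.toLp 2 torusLebesgue ℂ (x * R) := rfl

/-- The weighted inner product `∫ x * conj y * |R|²`. -/
def wip (R x y : CT) : ℂ := tint (x * star y * (R * star R))

theorem inner_toL2 (R x y : CT) : inner ℂ (toL2 R y) (toL2 R x) = wip R x y := by
  rw [toL2_apply, toL2_apply, ContinuousMap.inner_toLp, wip, tint_apply]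
  congr 1
  ext t
  simp only [ContinuousMap.mul_apply, ContinuousMap.star_apply, map_mul, RCLike.star_def]
  ring

theorem wip_add_left (R x x' y : CT) : wip R (x + x') y = wip R x y + wip R x' y := by
  rw [wip, add_mul, add_mul, map_add]; rfl

theorem wip_smul_left (R : CT) (c : ℂ) (x y : CT) : wip R (c • x) y = c * wip R x y := by
  rw [wip, smul_mul_assoc, smul_mul_assoc, map_smul]; rfl

theorem wip_conj (R x y : CT) : starRingEnd ℂ (wip R y x) = wip R x y := by
  rw [wip, ← tint_star, wip]
  congr 1
  simp only [star_mul', star_star]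
  ring

/-- The weighted inner product as a linear map in its first argument. -/
def wipL (R y : CT) : CT →ₗ[ℂ] ℂ where
  toFun x := wip R x y
  map_add' x x' := wip_add_left R x x' y
  map_smul' c x := wip_smul_left R c x y

theorem wip_add_right (R x y y' : CT) : wip R x (y + y') = wip R x y + wip R x y' := by
  rw [← wip_conj, wip_add_left, map_add, wip_conj, wip_conj]

theorem wip_smul_right (R : CT) (c : ℂ) (x y : CT) :
    wip R x (c • y) = starRingEnd ℂ c * wip R x y := by
  rw [← wip_conj, wip_smul_left, map_mul, wip_conj]

/-- The weighted inner product as a conjugate linear map in its second argument. -/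
def wipR (R x : CT) : CT →ₛₗ[starRingEnd ℂ] ℂ where
  toFun y := wip R x y
  map_add' y y' := wip_add_right R x y y'
  map_smul' c y := wip_smul_right R c x y

theorem wip_sum_left {ι : Type*} (R : CT) (F : Finset ι) (c : ι → ℂ) (x : ι → CT) (y : CT) :
    wip R (∑ i ∈ F, c i • x i) y = ∑ i ∈ F, c i * wip R (x i) y :=
  (map_sum (wipL R y) _ F).trans (Finset.sum_congr rfl fun _ _ => wip_smul_left R _ _ y)

theorem wip_sum_right {ι : Type*} (R : CT) (F : Finset ι) (c : ι → ℂ) (x : CT) (y : ι → CT) :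
    wip R x (∑ i ∈ F, c i • y i) = ∑ i ∈ F, starRingEnd ℂ (c i) * wip R x (y i) :=
  (map_sum (wipR R x) _ F).trans (Finset.sum_congr rfl fun _ _ => wip_smul_right R _ x _)

/-- Multiplication by a monomial is unitary for the weighted inner product. -/
theorem wip_mono_mul (R x y : CT) (s : ℤ × ℤ) : wip R (mono s * x) (mono s * y) = wip R x y := by
  have h : mono s * star (mono s) = 1 := by
    rw [star_mono, ← mono_add, add_neg_cancel, mono_zero]
  unfold wip
  congr 1
  rw [star_mul']
  linear_combination x * star y * (R * star R) * h

/-- Cauchy-Schwarz. -/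
theorem norm_wip_le (R x y : CT) : ‖wip R x y‖ ≤ ‖toL2 R x‖ * ‖toL2 R y‖ := by
  rw [← inner_toL2, mul_comm]
  exact norm_inner_le_norm _ _

theorem wip_self (R x : CT) : wip R x x = ((‖toL2 R x‖ ^ 2 : ℝ) : ℂ) := by
  rw [← inner_toL2, inner_self_eq_norm_sq_to_K]
  norm_cast

theorem norm_toL2_mono_mul (R x : CT) (s : ℤ × ℤ) : ‖toL2 R (mono s * x)‖ = ‖toL2 R x‖ := by
  have h := wip_mono_mul R x x s
  rw [wip_self, wip_self, Complex.ofReal_inj] at h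
  exact (pow_left_inj₀ (norm_nonneg _) (norm_nonneg _) two_ne_zero).1 h

/-- Compares with the unweighted norm `toL2 1`, for which the monomials are orthonormal. -/
theorem norm_toL2_le (R x : CT) : ‖toL2 R x‖ ≤ ‖R‖ * ‖toL2 1 x‖ := by
  refine Lp.norm_le_mul_norm_of_ae_le_mul ?_
  filter_upwards [ContinuousMap.coeFn_toLp (p := 2) (𝕜 := ℂ) torusLebesgue (x * R),
    ContinuousMap.coeFn_toLp (p := 2) (𝕜 := ℂ) torusLebesgue (x * 1)] with t h1 h2
  rw [toL2_apply, toL2_apply, h1, h2]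
  simp only [ContinuousMap.mul_apply, norm_mul, mul_one]
  rw [mul_comm]
  gcongr
  exact R.norm_coe_le_norm t

/-! ### Laurent polynomials with prescribed frequencies -/

/-- Laurent polynomials with frequencies in `S`. -/
def laurent (S : Set (ℤ × ℤ)) : Submodule ℂ CT := Submodule.span ℂ (mono '' S)

theorem mono_mem_laurent {S : Set (ℤ × ℤ)} {s : ℤ × ℤ} (hs : s ∈ S) : mono s ∈ laurent S :=
  Submodule.subset_span ⟨s, hs, rfl⟩

theorem laurent_le {S T : Set (ℤ × ℤ)} (h : S ⊆ T) : laurent S ≤ laurent T :=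
  Submodule.span_mono (Set.image_mono h)

theorem mul_mem_laurent {a b c d : ℤ × ℤ} {x y : CT} (hx : x ∈ laurent (Set.Icc a b))
    (hy : y ∈ laurent (Set.Icc c d)) : x * y ∈ laurent (Set.Icc (a + c) (b + d)) := by
  have h : laurent (Set.Icc a b) * laurent (Set.Icc c d) ≤ laurent (Set.Icc (a + c) (b + d)) := by
    rw [laurent, laurent, Submodule.span_mul_span, Submodule.span_le]
    rintro _ ⟨_, ⟨s, hs, rfl⟩, _, ⟨t, ht, rfl⟩, rfl⟩
    change mono s * mono t ∈ _
    rw [← mono_add]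
    exact mono_mem_laurent ⟨add_le_add hs.1 ht.1, add_le_add hs.2 ht.2⟩
  exact h (Submodule.mul_mem_mul hx hy)

theorem mono_mul_mem_laurent {a b : ℤ × ℤ} {x : CT} (s : ℤ × ℤ) (hx : x ∈ laurent (Set.Icc a b)) :
    mono s * x ∈ laurent (Set.Icc (s + a) (s + b)) :=
  mul_mem_laurent (mono_mem_laurent ⟨le_rfl, le_rfl⟩) hx

theorem star_mem_laurent {a b : ℤ × ℤ} {x : CT} (hx : x ∈ laurent (Set.Icc a b)) :
    star x ∈ laurent (Set.Icc (-b) (-a)) := by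
  refine Submodule.span_induction (p := fun x _ => star x ∈ laurent (Set.Icc (-b) (-a)))
    ?_ ?_ ?_ ?_ hx
  · rintro _ ⟨s, hs, rfl⟩
    rw [star_mono]
    exact mono_mem_laurent ⟨neg_le_neg hs.2, neg_le_neg hs.1⟩
  · rw [star_zero]
    exact Submodule.zero_mem _
  · intro x y _ _ hx hy
    rw [star_add]
    exact Submodule.add_mem _ hx hy
  · intro c x _ hx
    rw [star_smul]
    exact Submodule.smul_mem _ _ hx

/-- Semilinearity lets one statement serve both slots of `wip`, the second being conjugate linear.
-/
theorem eq_zero_of_mem_laurent {σ : ℂ →+* ℂ} (φ : CT →ₛₗ[σ] ℂ) {S : Set (ℤ × ℤ)} {x : CT}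
    (hx : x ∈ laurent S) (h : ∀ s ∈ S, φ (mono s) = 0) : φ x = 0 := by
  have : laurent S ≤ LinearMap.ker φ := by
    rw [laurent, Submodule.span_le]
    rintro _ ⟨s, hs, rfl⟩
    exact h s hs
  exact this hx

theorem wip_eq_zero_left {R y : CT} {S : Set (ℤ × ℤ)} {x : CT}
    (hx : x ∈ laurent S) (h : ∀ s ∈ S, wip R (mono s) y = 0) : wip R x y = 0 :=
  eq_zero_of_mem_laurent (wipL R y) hx h

theorem wip_eq_zero_right {R y : CT} {S : Set (ℤ × ℤ)} {x : CT}
    (hy : y ∈ laurent S) (h : ∀ s ∈ S, wip R x (mono s) = 0) : wip R x y = 0 :=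
  eq_zero_of_mem_laurent (wipR R x) hy h

theorem tint_mul_eq_zero {R : CT} {S : Set (ℤ × ℤ)} {x : CT}
    (hx : x ∈ laurent S) (h : ∀ s ∈ S, tint (mono s * R) = 0) : tint (x * R) = 0 :=
  eq_zero_of_mem_laurent (tint ∘ₗ LinearMap.mulRight ℂ R) hx h

/-- The coefficient of `mono s` in a Laurent polynomial. -/
def lcoeff (s : ℤ × ℤ) : CT →ₗ[ℂ] ℂ := tint ∘ₗ LinearMap.mulRight ℂ (mono (-s))

theorem lcoeff_apply (s : ℤ × ℤ) (x : CT) : lcoeff s x = tint (x * mono (-s)) := rfl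

theorem lcoeff_mono (s t : ℤ × ℤ) : lcoeff s (mono t) = if t = s then 1 else 0 := by
  rw [lcoeff_apply, ← mono_add, tint_mono]
  simp only [← sub_eq_add_neg, sub_eq_zero]

theorem lcoeff_eq_zero {S : Set (ℤ × ℤ)} {x : CT} (hx : x ∈ laurent S) {s : ℤ × ℤ}
    (hs : s ∉ S) : lcoeff s x = 0 :=
  eq_zero_of_mem_laurent _ hx fun t ht => by
    rw [lcoeff_mono, if_neg]
    rintro rfl
    exact hs ht

theorem eq_sum_lcoeff {F : Finset (ℤ × ℤ)} {x : CT} (hx : x ∈ laurent F) :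
    x = ∑ s ∈ F, lcoeff s x • mono s := by
  refine Submodule.span_induction (p := fun x _ => x = ∑ s ∈ F, lcoeff s x • mono s)
    ?_ ?_ ?_ ?_ hx
  · rintro _ ⟨t, ht, rfl⟩
    simp only [lcoeff_mono, ite_smul, one_smul, zero_smul]
    rw [Finset.sum_ite_eq, if_pos (Finset.mem_coe.1 ht)]
  · simp
  · intro x y _ _ hx hy
    simp only [map_add, add_smul, Finset.sum_add_distrib]
    rw [← hx, ← hy]
  · intro c x _ hx
    simp only [map_smul, smul_assoc, ← Finset.smul_sum]
    rw [← hx]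

theorem mem_laurent_of_lcoeff {F : Finset (ℤ × ℤ)} {T : Set (ℤ × ℤ)} {x : CT}
    (hx : x ∈ laurent F) (h : ∀ s ∈ F, s ∉ T → lcoeff s x = 0) : x ∈ laurent T := by
  rw [eq_sum_lcoeff hx]
  refine Submodule.sum_mem _ fun s hs => ?_
  by_cases hsT : s ∈ T
  · exact Submodule.smul_mem _ _ (mono_mem_laurent hsT)
  · rw [h s hs hsT, zero_smul]
    exact Submodule.zero_mem _

theorem mem_laurent_Icc_inf {a b c d : ℤ × ℤ} {x : CT}
    (hx : x ∈ laurent (Set.Icc a b)) (hy : x ∈ laurent (Set.Icc c d)) :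
    x ∈ laurent (Set.Icc (a ⊔ c) (b ⊓ d)) := by
  rw [← Set.Icc_inter_Icc]
  rw [← Finset.coe_Icc] at hx
  refine mem_laurent_of_lcoeff hx fun s hs hsT => lcoeff_eq_zero hy fun h => hsT ⟨?_, h⟩
  rwa [← Finset.coe_Icc]

/-! ### The banded biorthogonal family on the strip -/

/-- The rows `c ≤ k ≤ d` of the polynomial with coefficients `a`. -/
def rows (a : ℤ × ℤ → ℂ) (n c d : ℤ) : CT := ∑ s ∈ Finset.Icc (0, c) (n, d), a s • mono s

theorem rows_mem (a : ℤ × ℤ → ℂ) (n c d : ℤ) :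
    rows a n c d ∈ laurent (Set.Icc (0, c) (n, d)) :=
  Submodule.sum_mem _ fun s hs => Submodule.smul_mem _ _
    (mono_mem_laurent (by rwa [← Finset.coe_Icc]))

theorem rows_add_rows (a : ℤ × ℤ → ℂ) (n c l d : ℤ) (h1 : c ≤ l + 1) (h2 : l ≤ d) :
    rows a n c l + rows a n (l + 1) d = rows a n c d := by
  rw [rows, rows, ← Finset.sum_union]
  · refine Finset.sum_congr ?_ fun _ _ => rfl
    ext s
    simp only [Finset.mem_union, Finset.mem_Icc, Prod.le_def]
    omega
  · rw [Finset.disjoint_left]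
    intro s
    simp only [Finset.mem_Icc, Prod.le_def]
    omega

/-- The biorthogonal family of the monomials with `0 ≤ k ≤ m` for the weight `1 / |p|²`. -/
def dual (a : ℤ × ℤ → ℂ) (n m : ℤ) (t : ℤ × ℤ) : CT :=
  mono t * (rows a n 0 m * star (rows a n 0 t.2) -
    star (rows a n 0 m) * rows a n (m - t.2 + 1) m)

/-- Replacing each truncation of p by p minus the complementary rows produces |p|² twice, with
opposite signs. The defining form shows that the w-degrees are at least 0, this one that they are at
most m. -/
theorem dual_eq (a : ℤ × ℤ → ℂ) (n m : ℤ) (t : ℤ × ℤ) (h0 : 0 ≤ t.2) (hm : t.2 ≤ m) :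
    dual a n m t = mono t * (star (rows a n 0 m) * rows a n 0 (m - t.2) -
      rows a n 0 m * star (rows a n (t.2 + 1) m)) := by
  have h1 := rows_add_rows a n 0 t.2 m (by omega) hm
  have h2 := rows_add_rows a n 0 (m - t.2) m (by omega) (by omega)
  have h3 := congrArg star h1
  rw [star_add] at h3
  rw [dual]
  linear_combination mono t * rows a n 0 m * h3 - mono t * star (rows a n 0 m) * h2

/-- Translation invariance in z: the norms of the family depend on the row t.2 only, whence the
uniform bound `norm_toL2_dual_le`. -/
theorem dual_shift (a : ℤ × ℤ → ℂ) (n m : ℤ) (t : ℤ × ℤ) :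
    dual a n m t = mono (t.1, 0) * dual a n m (0, t.2) := by
  rw [dual, dual, ← mul_assoc (mono _) (mono _), ← mono_add]
  simp

theorem dual_mem (a : ℤ × ℤ → ℂ) (n m : ℤ) (t : ℤ × ℤ) (h0 : 0 ≤ t.2)
    (hm : t.2 ≤ m) :
    dual a n m t ∈ laurent (Set.Icc (t.1 - n, 0) (t.1 + n, m)) := by
  have hx : dual a n m t ∈ laurent (Set.Icc (t + (-n, -t.2)) (t + (n, m))) := by
    refine mono_mul_mem_laurent t (Submodule.sub_mem _ ?_ ?_)
    · refine laurent_le ?_ (mul_mem_laurent (rows_mem a n 0 m)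
        (star_mem_laurent (rows_mem a n 0 t.2)))
      apply Set.Icc_subset_Icc <;> simp
    · refine laurent_le ?_ (mul_mem_laurent (star_mem_laurent (rows_mem a n 0 m))
        (rows_mem a n (m - t.2 + 1) m))
      apply Set.Icc_subset_Icc <;> (simp [Prod.le_def]; try omega)
  have hy : dual a n m t ∈ laurent (Set.Icc (t + (-n, -m)) (t + (n, m - t.2))) := by
    rw [dual_eq a n m t h0 hm]
    refine mono_mul_mem_laurent t (Submodule.sub_mem _ ?_ ?_)
    · refine laurent_le ?_ (mul_mem_laurent (star_mem_laurent (rows_mem a n 0 m))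
        (rows_mem a n 0 (m - t.2)))
      apply Set.Icc_subset_Icc <;> simp
    · refine laurent_le ?_ (mul_mem_laurent (rows_mem a n 0 m)
        (star_mem_laurent (rows_mem a n (t.2 + 1) m)))
      apply Set.Icc_subset_Icc <;> (simp [Prod.le_def]; try omega)
  refine laurent_le ?_ (mem_laurent_Icc_inf hx hy)
  intro s
  simp only [Set.mem_Icc, Prod.le_def, Prod.fst_add, Prod.snd_add, Prod.fst_sup, Prod.snd_sup,
    Prod.fst_inf, Prod.snd_inf]
  omega

/-- The vanishing moments of `R = 1 / p`. -/
def HasMoments (R : CT) : Prop := ∀ s : ℤ × ℤ, 0 < s.1 ∨ 0 < s.2 → tint (mono s * R) = 0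

theorem HasMoments.tint_mul {R : CT} (hR : HasMoments R) {S : Set (ℤ × ℤ)} {x : CT}
    (hx : x ∈ laurent S) (hS : ∀ s ∈ S, 0 < s.1 ∨ 0 < s.2) : tint (x * R) = 0 :=
  tint_mul_eq_zero hx fun s hs => hR s (hS s hs)

theorem HasMoments.tint_mul_star {R : CT} (hR : HasMoments R) {S : Set (ℤ × ℤ)} {x : CT}
    (hx : x ∈ laurent S) (hS : ∀ s ∈ S, s.1 < 0 ∨ s.2 < 0) : tint (x * star R) = 0 := by
  refine tint_mul_eq_zero hx fun s hs => ?_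
  have h := hR (-s) (by simpa using hS s hs)
  rw [← star_mono] at h
  rw [← star_star (mono s), ← star_mul', tint_star, h, map_zero]

/-- Since pR = 1, the integrand becomes z^{s-t} (in multi-index notation) minus two error terms. One
is R times frequencies with positive w-exponent, the other conj R times frequencies with negative
w-exponent; both integrate to 0. -/
theorem wip_mono_dual {a : ℤ × ℤ → ℂ} {n m : ℤ} {R : CT} (hP : rows a n 0 m * R = 1)
    (hR : HasMoments R) (s t : ℤ × ℤ) (hs0 : 0 ≤ s.2) (hsm : s.2 ≤ m) (h0 : 0 ≤ t.2)
    (hm : t.2 ≤ m) : wip R (mono s) (dual a n m t) = if s = t then 1 else 0 := by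
  have hP' : star (rows a n 0 m) * star R = 1 := by rw [← star_mul', hP, star_one]
  have h1 := rows_add_rows a n 0 t.2 m (by omega) hm
  have key : mono s * star (dual a n m t) * (R * star R) =
      mono (s - t) - mono (s - t) * rows a n (t.2 + 1) m * R -
        mono (s - t) * star (rows a n (m - t.2 + 1) m) * star R := by
    rw [dual, star_mul', star_mono, star_sub, star_mul', star_mul', star_star, star_star,
      sub_eq_add_neg s t, mono_add]
    linear_combination mono s * mono (-t) * (rows a n 0 t.2 * R * hP' -
      star (rows a n (m - t.2 + 1) m) * star R * hP + R * h1 + hP)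
  have e1 : tint (mono (s - t) * rows a n (t.2 + 1) m * R) = 0 :=
    hR.tint_mul (mono_mul_mem_laurent (s - t) (rows_mem a n (t.2 + 1) m)) fun u hu => by
      simp only [Set.mem_Icc, Prod.le_def, Prod.fst_add, Prod.snd_add, Prod.snd_sub] at hu
      omega
  have e2 : tint (mono (s - t) * star (rows a n (m - t.2 + 1) m) * star R) = 0 :=
    hR.tint_mul_star (mono_mul_mem_laurent (s - t)
      (star_mem_laurent (rows_mem a n (m - t.2 + 1) m))) fun u hu => by
      simp only [Set.mem_Icc, Prod.le_def, Prod.fst_add, Prod.snd_add, Prod.snd_sub,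
        Prod.neg_mk] at hu
      omega
  rw [wip, key, map_sub, map_sub, e1, e2, sub_zero, sub_zero, tint_mono]
  simp only [sub_eq_zero]

/-! ### Vanishing of moments and of the top row -/

theorem eq_zero_of_increment_bound {A : ℕ → ℝ} {n : ℕ} {E B : ℝ} (hmono : Monotone A)
    (h0 : ∀ N, 0 ≤ A N) (h1 : ∀ N, A (N + n) ≤ E * (A (N + n) - A N))
    (h2 : ∀ N, A (N + n) ≤ B) (N : ℕ) : A N = 0 := by
  have hb : BddAbove (Set.range A) :=
    ⟨B, by rintro _ ⟨N, rfl⟩; exact (hmono (Nat.le_add_right N n)).trans (h2 N)⟩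
  have hl := tendsto_atTop_ciSup hmono hb
  have hl' := hl.comp (Filter.tendsto_add_atTop_nat n)
  -- A bounded monotone sequence converges, so its increments over n steps tend to 0 and the limit
  -- is at most E · 0.
  have h3 : (⨆ i, A i) ≤ E * ((⨆ i, A i) - ⨆ i, A i) :=
    le_of_tendsto_of_tendsto' hl' ((hl'.sub hl).const_mul E) h1
  rw [sub_self, mul_zero] at h3
  exact le_antisymm ((le_ciSup hb N).trans h3) (h0 N)

theorem wip_one_mono (s t : ℤ × ℤ) : wip 1 (mono s) (mono t) = if s = t then 1 else 0 := by
  rw [wip, star_mono, ← mono_add, star_one, mul_one, mul_one, tint_mono]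
  simp only [← sub_eq_add_neg, sub_eq_zero]

theorem le_of_sq_le_mul {u v : ℝ} (hu : 0 ≤ u) (hv : 0 ≤ v) (h : u ^ 2 ≤ v * u) : u ≤ v := by
  rcases hu.eq_or_lt with h0 | h0
  · exact h0 ▸ hv
  · exact le_of_mul_le_mul_right (by rwa [← sq]) h0

theorem norm_sq_toL2_one_sum (F : Finset (ℤ × ℤ)) (c : ℤ × ℤ → ℂ) :
    ‖toL2 1 (∑ s ∈ F, c s • mono s)‖ ^ 2 = ∑ s ∈ F, ‖c s‖ ^ 2 := by
  have h := wip_self 1 (∑ s ∈ F, c s • mono s)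
  rw [wip_sum_left] at h
  have h2 : ∀ s ∈ F, c s * wip 1 (mono s) (∑ t ∈ F, c t • mono t) = ((‖c s‖ ^ 2 : ℝ) : ℂ) := by
    intro s hs
    rw [wip_sum_right, Finset.sum_eq_single_of_mem s hs]
    · rw [wip_one_mono, if_pos rfl, mul_one, Complex.mul_conj']
      norm_cast
    · intro t _ hts
      rw [wip_one_mono, if_neg hts.symm, mul_zero]
  rw [Finset.sum_congr rfl h2, ← Complex.ofReal_sum, Complex.ofReal_inj] at h
  exact h.symm

/-- The norms of the elements of the biorthogonal family are bounded. -/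
theorem norm_toL2_dual_le (a : ℤ × ℤ → ℂ) (n m : ℤ) (R : CT) (t : ℤ × ℤ) (h0 : 0 ≤ t.2)
    (hm : t.2 ≤ m) :
    ‖toL2 R (dual a n m t)‖ ≤ ∑ k ∈ Finset.Icc 0 m, ‖toL2 R (dual a n m (0, k))‖ := by
  rw [dual_shift, norm_toL2_mono_mul]
  exact Finset.single_le_sum (f := fun k => ‖toL2 R (dual a n m (0, k))‖)
    (fun _ _ => norm_nonneg _) (Finset.mem_Icc.2 ⟨h0, hm⟩)

/-- A combination x of dual elements is built with the moments of f in the window S and zero moments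
elsewhere on the strip. Bandedness makes x orthogonal to every dual element indexed by S outside the
n outermost columns T, so the norm of x is controlled by T alone; pairing x with Σ c_s z^s recovers
the sum of squares over S. -/
theorem sum_sq_moments_le {a : ℤ × ℤ → ℂ} {n m : ℕ} {R : CT} (hP : rows a n 0 m * R = 1)
    (hR : HasMoments R) {f : CT}
    (hf : f ∈ laurent (Set.Icc 0 ((n : ℤ), (m : ℤ))))
    (horth : ∀ s : ℤ × ℤ, 0 ≤ s.1 → s.1 < n → 0 ≤ s.2 → s.2 ≤ m → wip R f (mono s) = 0) (N : ℕ) :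
    ∑ s ∈ Finset.Icc (-((N + n : ℕ) : ℤ), 0) (-1, (m : ℤ)), ‖wip R f (mono s)‖ ^ 2 ≤
      ‖R‖ ^ 2 * ((∑ s ∈ Finset.Icc (-((N + n : ℕ) : ℤ), 0) (-(N : ℤ) - 1, (m : ℤ)),
        ‖wip R f (mono s)‖) * ∑ k ∈ Finset.Icc 0 (m : ℤ), ‖toL2 R (dual a n m (0, k))‖) ^ 2 := by
  set S := Finset.Icc (-((N + n : ℕ) : ℤ), (0 : ℤ)) (-1, (m : ℤ)) with hS
  set T := Finset.Icc (-((N + n : ℕ) : ℤ), (0 : ℤ)) (-(N : ℤ) - 1, (m : ℤ)) with hT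
  set D := ∑ k ∈ Finset.Icc 0 (m : ℤ), ‖toL2 R (dual a n m (0, k))‖ with hD
  set c : ℤ × ℤ → ℂ := fun s => wip R f (mono s) with hc
  change ∑ s ∈ S, ‖c s‖ ^ 2 ≤ ‖R‖ ^ 2 * ((∑ s ∈ T, ‖c s‖) * D) ^ 2
  have memS : ∀ s, s ∈ S ↔ -((N + n : ℕ) : ℤ) ≤ s.1 ∧ s.1 ≤ -1 ∧ 0 ≤ s.2 ∧ s.2 ≤ m := by
    intro s
    simp only [hS, Finset.mem_Icc, Prod.le_def]
    tauto
  have memT : ∀ s, s ∈ T ↔ -((N + n : ℕ) : ℤ) ≤ s.1 ∧ s.1 ≤ -(N : ℤ) - 1 ∧ 0 ≤ s.2 ∧ s.2 ≤ m := by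
    intro s
    simp only [hT, Finset.mem_Icc, Prod.le_def]
    tauto
  have hTS : T ⊆ S := by
    intro s
    rw [memS, memT]
    omega
  set x : CT := ∑ s ∈ S, c s • dual a n m s with hx
  set y : CT := ∑ s ∈ S, c s • mono s with hy
  set z : CT := ∑ s ∈ T, c s • dual a n m s with hz
  have hdual : ∀ s t : ℤ × ℤ, 0 ≤ s.2 → s.2 ≤ m → 0 ≤ t.2 → t.2 ≤ m →
      wip R (dual a n m t) (mono s) = if t = s then 1 else 0 := by
    intro s t h1 h2 h3 h4
    rw [← wip_conj, wip_mono_dual hP hR s t h1 h2 h3 h4]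
    by_cases h : t = s
    · simp [h]
    · simp [h, Ne.symm h]
  have hxm : ∀ s : ℤ × ℤ, 0 ≤ s.2 → s.2 ≤ m →
      wip R x (mono s) = if s ∈ S then c s else 0 := by
    intro s h1 h2
    rw [hx, wip_sum_left, Finset.sum_congr rfl fun t ht => by
      rw [hdual s t h1 h2 ((memS t).1 ht).2.2.1 ((memS t).1 ht).2.2.2]]
    simp
  have hxd : ∀ t ∈ S, t ∉ T → wip R x (dual a n m t) = 0 := by
    intro t ht htT
    rw [memS] at ht
    rw [memT] at htT
    have hft : wip R f (dual a n m t) = 0 := by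
      refine wip_eq_zero_left hf fun s hs => ?_
      simp only [Set.mem_Icc, Prod.le_def, Prod.fst_zero, Prod.snd_zero] at hs
      rw [wip_mono_dual hP hR s t (by omega) (by omega) (by omega) (by omega), if_neg]
      rintro rfl
      omega
    -- Here -N ≤ t.1 ≤ -1, so the dual element has z-frequencies between -(N+n) and n-1. On the
    -- negative ones the moments of x and f agree; on the others both vanish, by `horth` for f.
    have hxf : wip R (x + (-1 : ℂ) • f) (dual a n m t) = 0 := by
      refine wip_eq_zero_right (dual_mem a n m t (by omega) (by omega)) fun s hs => ?_
      simp only [Set.mem_Icc, Prod.le_def] at hs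
      rw [wip_add_left, wip_smul_left, hxm s (by omega) (by omega)]
      by_cases hsS : s ∈ S
      · simp [hsS, hc]
      · rw [memS] at hsS
        rw [if_neg (by rwa [memS]), horth s (by omega) (by omega) (by omega) (by omega), mul_zero,
          add_zero]
    rwa [wip_add_left, wip_smul_left, hft, mul_zero, add_zero] at hxf
  -- Expanding the second x, only the terms indexed by T survive.
  have hxz : wip R x x = wip R x z := by
    conv_lhs => arg 3; rw [hx]
    rw [wip_sum_right, hz, wip_sum_right]
    refine (Finset.sum_subset hTS fun t ht htT => ?_).symm
    rw [hxd t ht htT, mul_zero]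
  have hxz' : ‖toL2 R x‖ ≤ ‖toL2 R z‖ := by
    have h1 := norm_wip_le R x z
    rw [← hxz, wip_self, Complex.norm_real, Real.norm_of_nonneg (by positivity)] at h1
    exact le_of_sq_le_mul (norm_nonneg _) (norm_nonneg _) (by rwa [mul_comm])
  have hzD : ‖toL2 R z‖ ≤ (∑ s ∈ T, ‖c s‖) * D := by
    rw [hz, map_sum, Finset.sum_mul]
    refine norm_sum_le_of_le _ fun s hs => ?_
    rw [map_smul, norm_smul]
    gcongr
    exact norm_toL2_dual_le a n m R s ((memT s).1 hs).2.2.1 ((memT s).1 hs).2.2.2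
  have hyR : ‖toL2 R y‖ ≤ ‖R‖ * ‖toL2 1 y‖ := norm_toL2_le R y
  have hy1 : ‖toL2 1 y‖ ^ 2 = ∑ s ∈ S, ‖c s‖ ^ 2 := norm_sq_toL2_one_sum S c
  have hxy : wip R x y = ((‖toL2 1 y‖ ^ 2 : ℝ) : ℂ) := by
    rw [hy1, hy, wip_sum_right, Complex.ofReal_sum]
    refine Finset.sum_congr rfl fun s hs => ?_
    rw [hxm s ((memS s).1 hs).2.2.1 ((memS s).1 hs).2.2.2, if_pos hs, Complex.conj_mul']
    norm_cast
  have h3 := norm_wip_le R x y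
  rw [hxy, Complex.norm_real, Real.norm_of_nonneg (by positivity)] at h3
  have h4 : ‖toL2 1 y‖ ≤ ‖R‖ * ((∑ s ∈ T, ‖c s‖) * D) := by
    have h5 := (norm_nonneg _).trans hzD
    refine le_of_sq_le_mul (norm_nonneg _) (mul_nonneg (norm_nonneg _) h5) (h3.trans ?_)
    calc ‖toL2 R x‖ * ‖toL2 R y‖ ≤ ((∑ s ∈ T, ‖c s‖) * D) * (‖R‖ * ‖toL2 1 y‖) :=
          mul_le_mul (hxz'.trans hzD) hyR (norm_nonneg _) h5
      _ = _ := by ring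
  rw [← hy1, ← mul_pow]
  exact pow_le_pow_left₀ (norm_nonneg _) h4 2

/-- A polynomial that is orthogonal to the monomials `z ^ j * w ^ k`, `0 ≤ j < n`, `0 ≤ k ≤ m`, is
orthogonal to those with `j < 0` as well. -/
theorem moment_eq_zero_of_neg {a : ℤ × ℤ → ℂ} {n m : ℕ} {R : CT} (hP : rows a n 0 m * R = 1)
    (hR : HasMoments R) {f : CT}
    (hf : f ∈ laurent (Set.Icc 0 ((n : ℤ), (m : ℤ))))
    (horth : ∀ s : ℤ × ℤ, 0 ≤ s.1 → s.1 < n → 0 ≤ s.2 → s.2 ≤ m → wip R f (mono s) = 0)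
    (s : ℤ × ℤ) (hs : s.1 < 0) (h0 : 0 ≤ s.2) (hm : s.2 ≤ m) : wip R f (mono s) = 0 := by
  set c : ℤ × ℤ → ℂ := fun s => wip R f (mono s) with hc
  set D := ∑ k ∈ Finset.Icc 0 (m : ℤ), ‖toL2 R (dual a n m (0, k))‖ with hD
  let A : ℕ → ℝ := fun N => ∑ s ∈ Finset.Icc (-(N : ℤ), 0) (-1, (m : ℤ)), ‖c s‖ ^ 2
  let T : ℕ → Finset (ℤ × ℤ) := fun N =>
    Finset.Icc (-((N + n : ℕ) : ℤ), (0 : ℤ)) (-(N : ℤ) - 1, (m : ℤ))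
  -- The size is independent of N, which makes the Cauchy-Schwarz constant in `hE` and the bound in
  -- `hB` uniform.
  have hcard : ∀ N, (T N).card = n * (m + 1) := by
    intro N
    simp only [T, Finset.card_Icc_prod, Int.card_Icc]
    congr 1 <;> omega
  have hAT : ∀ N, A (N + n) - A N = ∑ s ∈ T N, ‖c s‖ ^ 2 := by
    intro N
    rw [sub_eq_iff_eq_add, ← Finset.sum_union]
    · refine Finset.sum_congr ?_ fun _ _ => rfl
      ext u
      simp only [T, Finset.mem_union, Finset.mem_Icc, Prod.le_def]
      omega
    · rw [Finset.disjoint_left]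
      intro u
      simp only [T, Finset.mem_Icc, Prod.le_def]
      omega
  have hA0 : ∀ N, 0 ≤ A N := fun N => Finset.sum_nonneg fun _ _ => by positivity
  have hmonoA : Monotone A := by
    intro N N' h
    refine Finset.sum_le_sum_of_subset_of_nonneg (Finset.Icc_subset_Icc ?_ le_rfl)
      fun _ _ _ => by positivity
    simpa [Prod.le_def] using h
  -- All monomials have the same weighted norm as 1.
  have hcb : ∀ u, ‖c u‖ ≤ ‖toL2 R f‖ * ‖toL2 R 1‖ := by
    intro u
    refine (norm_wip_le R f (mono u)).trans ?_
    rw [← mul_one (mono u), norm_toL2_mono_mul]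
  have hmain := sum_sq_moments_le hP hR hf horth
  have hE : ∀ N, A (N + n) ≤ (‖R‖ ^ 2 * D ^ 2 * (n * (m + 1) : ℕ)) * (A (N + n) - A N) := by
    intro N
    rw [hAT]
    refine (hmain N).trans ?_
    have := sq_sum_le_card_mul_sum_sq (s := T N) (f := fun u => ‖c u‖)
    rw [hcard] at this
    rw [mul_pow]
    calc ‖R‖ ^ 2 * ((∑ u ∈ T N, ‖c u‖) ^ 2 * D ^ 2)
        = ‖R‖ ^ 2 * D ^ 2 * (∑ u ∈ T N, ‖c u‖) ^ 2 := by ring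
      _ ≤ ‖R‖ ^ 2 * D ^ 2 * ((n * (m + 1) : ℕ) * ∑ u ∈ T N, ‖c u‖ ^ 2) := by gcongr
      _ = _ := by ring
  have hB : ∀ N, A (N + n) ≤
      ‖R‖ ^ 2 * (((n * (m + 1) : ℕ) * (‖toL2 R f‖ * ‖toL2 R 1‖)) * D) ^ 2 := by
    intro N
    refine (hmain N).trans ?_
    have h1 : ∑ u ∈ T N, ‖c u‖ ≤ (n * (m + 1) : ℕ) * (‖toL2 R f‖ * ‖toL2 R 1‖) := by
      rw [← hcard N, ← nsmul_eq_mul]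
      exact Finset.sum_le_card_nsmul _ _ _ fun u _ => hcb u
    have hD0 : 0 ≤ D := Finset.sum_nonneg fun _ _ => norm_nonneg _
    have h2 : 0 ≤ ∑ u ∈ T N, ‖c u‖ := Finset.sum_nonneg fun _ _ => norm_nonneg _
    change ‖R‖ ^ 2 * ((∑ u ∈ T N, ‖c u‖) * D) ^ 2 ≤ _
    gcongr
  have hfin := eq_zero_of_increment_bound hmonoA hA0 hE hB s.1.natAbs
  rw [Finset.sum_eq_zero_iff_of_nonneg fun _ _ => by positivity] at hfin
  have := hfin s (by simp only [Finset.mem_Icc, Prod.le_def]; omega)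
  simpa using this

/-- The coefficient is an integral of f z^{-j} w^{-m}; inserting 1 = conj p · conj R splits it along
the rows of p. Row 0 gives the integrals in `key`, and the higher rows leave only negative powers of
w against conj R. -/
theorem lcoeff_top_eq_zero {a : ℤ × ℤ → ℂ} {n m : ℕ} {R : CT} (hP : rows a n 0 m * R = 1)
    (hR : HasMoments R) {f : CT}
    (hf : f ∈ laurent (Set.Icc 0 ((n : ℤ), (m : ℤ)) \ {((n : ℤ), (m : ℤ))}))
    (horth : ∀ s : ℤ × ℤ, 0 ≤ s.1 → s.1 < n → 0 ≤ s.2 → s.2 ≤ m → wip R f (mono s) = 0) (j : ℤ) :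
    lcoeff (j, m) f = 0 := by
  have hf' : f ∈ laurent (Set.Icc 0 ((n : ℤ), (m : ℤ))) := laurent_le Set.sdiff_subset hf
  have key : ∀ i : ℤ, tint (f * (mono (i, -m) * star R)) = 0 := by
    intro i
    -- For i ≤ -n every frequency of f z^i w^{-m} has a negative component; when i = -n this needs
    -- (n, m) to be missing from f. For i > -n, conj R = p|R|² turns the integral into a pairing of
    -- f with z^{-i} w^m conj p, whose z-frequencies are all below n.
    rcases le_or_gt i (-n) with hi | hi
    · refine tint_mul_eq_zero hf fun s hs => ?_
      rw [← mul_assoc, ← mono_add]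
      refine hR.tint_mul_star (mono_mem_laurent (S := {s + (i, -(m : ℤ))}) rfl) ?_
      rintro u rfl
      simp only [Set.mem_sdiff, Set.mem_Icc, Prod.le_def, Set.mem_singleton_iff, Prod.ext_iff,
        Prod.fst_zero, Prod.snd_zero] at hs
      simp only [Prod.fst_add, Prod.snd_add]
      omega
    · have h1 : wip R f (mono (-i, m) * star (rows a n 0 m)) = 0 := by
        refine wip_eq_zero_right (mono_mul_mem_laurent (-i, (m : ℤ))
          (star_mem_laurent (rows_mem a n 0 m))) fun s hs => ?_
        simp only [Set.mem_Icc, Prod.le_def, Prod.fst_add, Prod.snd_add, Prod.neg_mk] at hs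
        rcases lt_or_ge s.1 0 with h | h
        · exact moment_eq_zero_of_neg hP hR hf' horth s h (by omega) (by omega)
        · exact horth s h (by omega) (by omega) (by omega)
      rw [← h1, wip]
      congr 1
      rw [star_mul', star_star, star_mono, Prod.neg_mk, neg_neg]
      linear_combination -(f * mono (i, -(m : ℤ)) * star R) * hP
  have h1 := congrArg star (rows_add_rows a n 0 0 m (by omega) (by omega))
  have hP' : star (rows a n 0 m) * star R = 1 := by rw [← star_mul', hP, star_one]
  rw [star_add] at h1
  have e : f * mono (-(j, (m : ℤ))) = star (rows a n 0 0) * (f * mono (-j, -(m : ℤ)) * star R) +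
      f * (mono (-j, -(m : ℤ)) * star (rows a n (0 + 1) m)) * star R := by
    rw [Prod.neg_mk]
    linear_combination -(f * mono (-j, -(m : ℤ))) * hP' -
      (f * mono (-j, -(m : ℤ)) * star R) * h1
  rw [lcoeff_apply, e, map_add]
  have e1 : tint (star (rows a n 0 0) * (f * mono (-j, -(m : ℤ)) * star R)) = 0 := by
    refine tint_mul_eq_zero (star_mem_laurent (rows_mem a n 0 0)) fun s hs => ?_
    simp only [Set.mem_Icc, Prod.le_def, Prod.neg_mk] at hs
    rw [← key (s.1 - j)]
    congr 1
    have : ((s.1 - j, -(m : ℤ)) : ℤ × ℤ) = s + (-j, -(m : ℤ)) := by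
      ext
      · simp [sub_eq_add_neg]
      · simp; omega
    rw [this, mono_add]
    ring
  have e2 : tint (f * (mono (-j, -(m : ℤ)) * star (rows a n (0 + 1) m)) * star R) = 0 := by
    refine hR.tint_mul_star (mul_mem_laurent hf' (mono_mul_mem_laurent _
      (star_mem_laurent (rows_mem a n (0 + 1) m)))) fun s hs => ?_
    simp only [Set.mem_Icc, Prod.le_def, Prod.fst_add, Prod.snd_add, Prod.neg_mk] at hs
    omega
  rw [e1, e2, add_zero]

/-! ### Polynomials as Laurent polynomials on the torus -/

/-- Restriction of a polynomial to the torus. -/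
def restrict : Poly →ₐ[ℂ] CT := MvPolynomial.aeval ![mono (1, 0), mono (0, 1)]

theorem restrict_apply (P : Poly) (t : Torus) : restrict P t = value P (toC2 t) := by
  induction P using MvPolynomial.induction_on with
  | C c => simp [restrict, value, Algebra.algebraMap_eq_smul_one]
  | add P Q hP hQ => simp only [map_add, ContinuousMap.add_apply, hP, hQ]; simp [value]
  | mul_X P i hP =>
    rw [map_mul, ContinuousMap.mul_apply, hP]
    fin_cases i <;> simp [value, restrict, mono_apply, toC2]

/-- The exponent of `z ^ j * w ^ k`. -/
def expo (jk : ℕ × ℕ) : Fin 2 →₀ ℕ := Finsupp.single 0 jk.1 + Finsupp.single 1 jk.2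

theorem expo_injective : Function.Injective expo := by
  intro s t h
  have h0 := DFunLike.congr_fun h 0
  have h1 := DFunLike.congr_fun h 1
  simp [expo] at h0 h1
  exact Prod.ext h0 h1

theorem expo_surjective (d : Fin 2 →₀ ℕ) : expo (d 0, d 1) = d := by
  ext i
  fin_cases i <;> simp [expo]

theorem X_pow_mul_X_pow (jk : ℕ × ℕ) :
    (MvPolynomial.X 0 ^ jk.1 * MvPolynomial.X 1 ^ jk.2 : Poly) =
      MvPolynomial.monomial (expo jk) 1 := by
  rw [MvPolynomial.X_pow_eq_monomial, MvPolynomial.X_pow_eq_monomial,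
    MvPolynomial.monomial_mul, one_mul, expo]

theorem mem_monomialSpan {S : Set (ℕ × ℕ)} {P : Poly} :
    P ∈ monomialSpan S ↔ ∀ jk, jk ∉ S → MvPolynomial.coeff (expo jk) P = 0 := by
  have : monomialSpan S = MvPolynomial.restrictSupport ℂ (expo '' S) := by
    rw [monomialSpan, MvPolynomial.restrictSupport_eq_span, Set.image_image]
    simp only [X_pow_mul_X_pow]
  rw [this, MvPolynomial.mem_restrictSupport_iff]
  constructor
  · intro h jk hjk
    by_contra h0
    obtain ⟨t, ht, hts⟩ := h (MvPolynomial.mem_support_iff.2 h0)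
    exact hjk (expo_injective hts ▸ ht)
  · intro h d hd
    rw [← expo_surjective d] at hd ⊢
    refine ⟨_, ?_, rfl⟩
    by_contra h0
    exact MvPolynomial.mem_support_iff.1 hd (h _ h0)

/-- The inclusion of exponents of polynomials in those of Laurent polynomials. -/
def castExp (jk : ℕ × ℕ) : ℤ × ℤ := (jk.1, jk.2)

theorem restrict_X_pow (jk : ℕ × ℕ) :
    restrict (MvPolynomial.X 0 ^ jk.1 * MvPolynomial.X 1 ^ jk.2 : Poly) = mono (castExp jk) := by
  ext t
  rw [restrict_apply, mono_apply]
  simp [value, toC2, castExp]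

theorem restrict_mem_laurent {S : Set (ℕ × ℕ)} {P : Poly} (hP : P ∈ monomialSpan S)
    {T : Set (ℤ × ℤ)} (hT : ∀ jk ∈ S, castExp jk ∈ T) : restrict P ∈ laurent T := by
  have : monomialSpan S ≤ (laurent T).comap restrict.toLinearMap := by
    rw [monomialSpan, Submodule.span_le]
    rintro _ ⟨jk, hjk, rfl⟩
    change restrict _ ∈ laurent T
    rw [restrict_X_pow]
    exact mono_mem_laurent (hT jk hjk)
  exact this hP

theorem lcoeff_restrict (jk : ℕ × ℕ) (P : Poly) :
    lcoeff (castExp jk) (restrict P) = MvPolynomial.coeff (expo jk) P := by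
  induction P using MvPolynomial.induction_on' with
  | add P Q hP hQ => rw [map_add, map_add, MvPolynomial.coeff_add, hP, hQ]
  | monomial d c =>
    have h : (MvPolynomial.monomial d c : Poly) = c • MvPolynomial.monomial d 1 := by
      rw [MvPolynomial.smul_monomial, smul_eq_mul, mul_one]
    rw [h, map_smul, map_smul, MvPolynomial.coeff_smul, ← expo_surjective d, ← X_pow_mul_X_pow,
      restrict_X_pow, lcoeff_mono, X_pow_mul_X_pow, MvPolynomial.coeff_monomial]
    congr 1
    refine if_congr ?_ rfl rfl
    rw [expo_injective.eq_iff]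
    simp [castExp, Prod.ext_iff]

theorem poly_ext {P Q : Poly} (h : ∀ x : ℂ × ℂ, value P x = value Q x) : P = Q := by
  refine MvPolynomial.funext fun x => ?_
  have hx : x = ![x 0, x 1] := by
    ext i
    fin_cases i <;> rfl
  rw [hx]
  exact h (x 0, x 1)

theorem differentiable_value (P : Poly) {f g : ℂ → ℂ} (hf : Differentiable ℂ f)
    (hg : Differentiable ℂ g) : Differentiable ℂ fun z => value P (f z, g z) := by
  induction P using MvPolynomial.induction_on with
  | C c => simp [value]
  | add P Q hP hQ =>
    simp only [value, map_add] at hP hQ ⊢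
    exact hP.add hQ
  | mul_X P i hP =>
    simp only [value, map_mul, MvPolynomial.eval_X] at hP ⊢
    fin_cases i
    · exact hP.mul hf
    · exact hP.mul hg

/-! ### Stable polynomials and their Bernstein–Szegő measures -/

theorem Stable.restrict_ne_zero {p : Poly} (hp : Stable p) (t : Torus) : restrict p t ≠ 0 := by
  rw [restrict_apply]
  exact hp _ _ (Circle.norm_coe t.1).le (Circle.norm_coe t.2).le

/-- The function `1 / p` on the torus. -/
def Stable.inv {p : Poly} (hp : Stable p) : CT :=
  ⟨fun t => (restrict p t)⁻¹, (restrict p).continuous.inv₀ hp.restrict_ne_zero⟩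

theorem Stable.inv_apply {p : Poly} (hp : Stable p) (t : Torus) :
    hp.inv t = (value p (toC2 t))⁻¹ := by
  rw [← restrict_apply]
  rfl

theorem Stable.mul_inv {p : Poly} (hp : Stable p) : restrict p * hp.inv = 1 := by
  ext t
  exact mul_inv_cancel₀ (hp.restrict_ne_zero t)

theorem Stable.hasMoments_inv {p : Poly} (hp : Stable p) : HasMoments hp.inv := by
  refine tint_mono_mul_eq_zero hp.inv (fun z w => (value p (z, w))⁻¹) hp.inv_apply
    (fun w => ?_) (fun z => ?_)
  · refine DifferentiableOn.diffContOnCl ?_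
    rw [closure_ball _ one_ne_zero]
    exact (differentiable_value p differentiable_id (differentiable_const (w : ℂ))).differentiableOn.inv fun z hz =>
      hp z w (by simpa using hz) (Circle.norm_coe w).le
  · refine DifferentiableOn.diffContOnCl ?_
    rw [closure_ball _ one_ne_zero]
    exact (differentiable_value p (differentiable_const (z : ℂ)) differentiable_id).differentiableOn.inv fun w hw =>
      hp z w (Circle.norm_coe z).le (by simpa using hw)

theorem Stable.continuous_density {p : Poly} (hp : Stable p) :
    Continuous fun t : Torus => 1 / ‖value p (toC2 t)‖ ^ 2 := by
  refine continuous_const.div ((continuous_value p).norm.pow 2) fun t => ?_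
  rw [← restrict_apply]
  exact pow_ne_zero 2 (norm_ne_zero_iff.2 (hp.restrict_ne_zero t))

theorem Stable.isFiniteMeasure_bernsteinSzego {p : Poly} (hp : Stable p) :
    IsFiniteMeasure (bernsteinSzego p) := by
  refine isFiniteMeasure_withDensity_ofReal ?_
  have := (BoundedContinuousFunction.mkOfCompact ⟨_, hp.continuous_density⟩).integrable
    torusLebesgue
  exact this.2

theorem Stable.ip_bernsteinSzego {p : Poly} (hp : Stable p) (P Q : Poly) :
    ip (bernsteinSzego p) P Q = wip hp.inv (restrict P) (restrict Q) := by
  rw [ip, bernsteinSzego, integral_withDensity_eq_integral_toReal_smul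
    hp.continuous_density.measurable.ennreal_ofReal
    (Filter.Eventually.of_forall fun _ => ENNReal.ofReal_lt_top), wip, tint_apply]
  congr 1
  ext t
  rw [ENNReal.toReal_ofReal (by positivity)]
  simp only [ContinuousMap.mul_apply, ContinuousMap.star_apply, restrict_apply, hp.inv_apply,
    RCLike.star_def]
  rw [Complex.mul_conj', Complex.real_smul, norm_inv]
  push_cast
  ring

theorem Stable.nondegenerate_bernsteinSzego {p : Poly} (hp : Stable p) (n m : ℕ) :
    Nondegenerate (bernsteinSzego p) n m := by
  intro P _ h0
  have h1 : toL2 hp.inv (restrict P) = 0 := by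
    rw [pnorm, hp.ip_bernsteinSzego, wip_self, Complex.ofReal_re, Real.sqrt_sq (norm_nonneg _),
      norm_eq_zero] at h0
    exact h0
  ext d
  rw [← expo_surjective d, ← lcoeff_restrict, lcoeff_apply, MvPolynomial.coeff_zero]
  -- The factor |p|² cancels the weight, so this pairing is a plain Fourier coefficient of P.
  have h2 := norm_wip_le hp.inv (restrict P)
    (mono (castExp (d 0, d 1)) * (restrict p * star (restrict p)))
  rw [h1, norm_zero, zero_mul, norm_le_zero_iff, wip] at h2
  rw [← h2]
  have hp' : star (restrict p) * star hp.inv = 1 := by rw [← star_mul', hp.mul_inv, star_one]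
  congr 1
  simp only [star_mul', star_star, star_mono]
  linear_combination -(restrict P * mono (-castExp (d 0, d 1)) * (restrict p * hp.inv)) * hp' -
    (restrict P * mono (-castExp (d 0, d 1))) * hp.mul_inv

/-! ### Projections, boxes and reproducing kernels -/

theorem ip_sub_left (ρ : Measure Torus) [IsFiniteMeasure ρ] (P P' Q : Poly) :
    ip ρ (P - P') Q = ip ρ P Q - ip ρ P' Q := by
  have e : P - P' = P + (-1 : ℂ) • P' := by simp [sub_eq_add_neg]
  rw [e, ip_add_left, ip_smul_left]
  ring

theorem ip_add_right (ρ : Measure Torus) [IsFiniteMeasure ρ] (P Q Q' : Poly) :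
    ip ρ P (Q + Q') = ip ρ P Q + ip ρ P Q' := by
  rw [← ip_conj, ip_add_left, map_add, ip_conj, ip_conj]

theorem ip_smul_right (ρ : Measure Torus) (c : ℂ) (P Q : Poly) :
    ip ρ P (c • Q) = starRingEnd ℂ c * ip ρ P Q := by
  rw [← ip_conj, ip_smul_left, map_mul, ip_conj]

/-- Orthogonal projection onto a finite dimensional space of polynomials. -/
theorem exists_projection (ρ : Measure Torus) [IsFiniteMeasure ρ]
    (W : Submodule ℂ Poly) [FiniteDimensional ℂ W]
    (hW : ∀ P ∈ W, pnorm ρ P = 0 → P = 0) (f : Poly) :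
    ∃ v ∈ W, ∀ Q ∈ W, ip ρ (f - v) Q = 0 := by
  let core : InnerProductSpace.Core ℂ W :=
    { inner := fun P Q => ip ρ Q P
      conj_inner_symm := fun P Q => ip_conj ρ _ _
      re_inner_nonneg := fun P => by
        change 0 ≤ (ip ρ (P : Poly) P).re
        rw [ip_self, Complex.ofReal_re]
        exact integral_nonneg fun t => by positivity
      add_left := fun P P' Q => ip_add_right ρ _ _ _
      smul_left := fun P Q c => ip_smul_right ρ c _ _
      definite := fun P h => Subtype.ext (hW P P.2 (by
        change ip ρ (P : Poly) P = 0 at h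
        simp [pnorm, h])) }
  let φ : W →ₗ[ℂ] ℂ :=
    { toFun := fun P => ip ρ P f
      map_add' := fun P Q => ip_add_left ρ _ _ _
      map_smul' := fun c P => ip_smul_left ρ c _ _ }
  obtain ⟨K, hK⟩ := exists_riesz core φ
  refine ⟨K, K.2, fun Q hQ => ?_⟩
  have h : ip ρ Q K = ip ρ Q f := hK ⟨Q, hQ⟩
  rw [ip_sub_left, ← ip_conj ρ f, ← ip_conj ρ (K : Poly), h, sub_self]

theorem monomialSpan_mono {S T : Set (ℕ × ℕ)} (h : S ⊆ T) : monomialSpan S ≤ monomialSpan T :=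
  Submodule.span_mono (Set.image_mono h)

theorem boxUR_le_box (n m : ℕ) : boxUR n m ≤ box n m := monomialSpan_mono fun _ h => ⟨h.1, h.2.1⟩

theorem boxR_le_boxUR (n m : ℕ) : boxR n m ≤ boxUR n m := monomialSpan_mono fun jk h => by
  obtain ⟨h1, h2⟩ := h
  exact ⟨h1.le, h2, fun h => by simp [h] at h1⟩

theorem boxU_le_boxUR (n m : ℕ) : boxU n m ≤ boxUR n m := monomialSpan_mono fun jk h => by
  obtain ⟨h1, h2⟩ := h
  exact ⟨h1, h2.le, fun h => by simp [h] at h2⟩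

theorem boxSM_le_boxR (n m : ℕ) : boxSM n m ≤ boxR n m :=
  monomialSpan_mono fun _ h => ⟨h.1, h.2.le⟩

theorem mem_boxSM {n m : ℕ} {P : Poly} (hU : P ∈ boxU n m) (hR : P ∈ boxR n m) :
    P ∈ boxSM n m := by
  refine mem_monomialSpan.2 fun jk hjk => ?_
  by_cases h : jk.1 < n
  · refine mem_monomialSpan.1 hU jk fun h' => hjk ⟨h, h'.2⟩
  · exact mem_monomialSpan.1 hR jk fun h' => h h'.1

/-- The kernel section at the origin is conj(p(0,0)) · p and lies in the box; stability gives p(0,0)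
≠ 0. -/
theorem kernelPolynomial_mem_box {ρ : Measure Torus} [IsFiniteMeasure ρ] {n m : ℕ}
    (hρ : Nondegenerate ρ n m) {p : Poly} (hp : IsKernelPolynomial ρ n m p) (hs : Stable p) :
    p ∈ box n m := by
  have h0 : value p (0, 0) ≠ 0 := hs 0 0 (by simp) (by simp)
  have hK := (kernelAt_ominus_represents ρ n m hρ (boxLL n m) (0, 0)).1.1
  have e : kernelAt ρ (ominus ρ (box n m) (boxLL n m)) (0, 0) =
      starRingEnd ℂ (value p (0, 0)) • p := by
    refine poly_ext fun x => ?_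
    have := hp.2 x (0, 0)
    rw [kernel] at this
    rw [this]
    simp [value, MvPolynomial.smul_eval, mul_comm]
  rw [e] at hK
  exact ((box n m).smul_mem_iff ((map_ne_zero _).2 h0)).1 hK

/-- The reproducing kernel determines the inner product. -/
theorem ip_eq_of_kernel_eq {ρ μ : Measure Torus} [IsFiniteMeasure ρ] [IsFiniteMeasure μ] {n m : ℕ}
    (hρ : Nondegenerate ρ n m) (hμ : Nondegenerate μ n m)
    (h : kernel μ (box n m) = kernel ρ (box n m)) {P Q : Poly} (hP : P ∈ box n m)
    (hQ : Q ∈ box n m) : ip ρ P Q = ip μ P Q := by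
  have hK : ∀ y, kernelAt μ (box n m) y = kernelAt ρ (box n m) y := fun y =>
    poly_ext fun x => congrFun (congrFun h x) y
  have hrep := kernelAt_box_represents ρ n m hρ
  have hrep' := kernelAt_box_represents μ n m hμ
  let W : Submodule ℂ Poly := Submodule.span ℂ (Set.range (kernelAt ρ (box n m)))
  have hW : W ≤ box n m := by
    rw [Submodule.span_le]
    rintro _ ⟨y, rfl⟩
    exact (hrep y).1
  have := finiteDimensional_box n m
  have : FiniteDimensional ℂ W := Submodule.finiteDimensional_of_le hW
  obtain ⟨v, hv, hv0⟩ := exists_projection ρ W (fun P hP => hρ P (hW hP)) Q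
  -- Being orthogonal to every kernel section means vanishing at every point, so the sections span
  -- the box. On them both inner products are evaluation.
  have hQv : Q - v = 0 := poly_ext fun y => by
    rw [← (hrep y).2 _ (Submodule.sub_mem _ hQ (hW hv)),
      hv0 _ (Submodule.subset_span ⟨y, rfl⟩)]
    simp [value]
  rw [sub_eq_zero.1 hQv]
  refine Submodule.span_induction (p := fun Q _ => ip ρ P Q = ip μ P Q) ?_ ?_ ?_ ?_ hv
  · rintro _ ⟨y, rfl⟩
    rw [(hrep y).2 P hP, ← hK, (hrep' y).2 P hP]
  · simp [ip, value]
  · intro Q Q' _ _ h1 h2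
    rw [ip_add_right, ip_add_right, h1, h2]
  · intro c Q _ h1
    rw [ip_smul_right, ip_smul_right, h1]

/-! ### The two inclusions -/

theorem mem_boxU_of_orthogonal {n m : ℕ} {p : Poly} (hs : Stable p) (hp : p ∈ box n m) {f : Poly}
    (hf : f ∈ boxUR n m) (horth : ∀ Q ∈ boxR n m, ip (bernsteinSzego p) f Q = 0) :
    f ∈ boxU n m := by
  have hp' : restrict p ∈ laurent (Finset.Icc (0, 0) ((n : ℤ), (m : ℤ))) :=
    restrict_mem_laurent hp fun jk h => by
      simpa [castExp, Prod.le_def] using h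
  have hP : rows (fun s => lcoeff s (restrict p)) n 0 m * hs.inv = 1 := by
    rw [rows, ← eq_sum_lcoeff hp', hs.mul_inv]
  have hf' : restrict f ∈ laurent (Set.Icc 0 ((n : ℤ), (m : ℤ)) \ {((n : ℤ), (m : ℤ))}) :=
    restrict_mem_laurent hf fun jk h => by
      obtain ⟨h1, h2, h3⟩ := h
      refine ⟨by simp [castExp, Prod.le_def, h1, h2], fun h => h3 ?_⟩
      simpa [castExp, Prod.ext_iff] using h
  have horth' : ∀ s : ℤ × ℤ, 0 ≤ s.1 → s.1 < n → 0 ≤ s.2 → s.2 ≤ m →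
      wip hs.inv (restrict f) (mono s) = 0 := by
    rintro ⟨j, k⟩ h1 h2 h3 h4
    lift j to ℕ using h1
    lift k to ℕ using h3
    rw [← horth (MvPolynomial.X 0 ^ j * MvPolynomial.X 1 ^ k)
      (Submodule.subset_span ⟨(j, k), ⟨by simpa using h2, by simpa using h4⟩, rfl⟩),
      hs.ip_bernsteinSzego, restrict_X_pow (j, k)]
    rfl
  refine mem_monomialSpan.2 fun jk hjk => ?_
  by_cases h : jk.2 = m
  · rw [← lcoeff_restrict, ← lcoeff_top_eq_zero hP hs.hasMoments_inv hf' horth' jk.1, castExp, h]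
  · refine mem_monomialSpan.1 hf jk fun h' => hjk ⟨h'.1, lt_of_le_of_ne h'.2.1 h⟩

end

end TorusPoly

open TorusPoly in
theorem mainTheorem8 (n m : ℕ) (hn : 0 < n) (hm : 0 < m)
    (ρ : MeasureTheory.Measure TorusPoly.Torus) [MeasureTheory.IsProbabilityMeasure ρ]
    (hρ : TorusPoly.Nondegenerate ρ n m)
    (p : TorusPoly.Poly) (hp : TorusPoly.IsKernelPolynomial ρ n m p)
    (hstable : TorusPoly.Stable p)
    (hker : TorusPoly.kernel (TorusPoly.bernsteinSzego p) (TorusPoly.box n m) =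
      TorusPoly.kernel ρ (TorusPoly.box n m)) :
    TorusPoly.ominus ρ (TorusPoly.boxUR n m) (TorusPoly.boxR n m) =
      TorusPoly.ominus ρ (TorusPoly.boxU n m) (TorusPoly.boxSM n m) := by
  have := hstable.isFiniteMeasure_bernsteinSzego
  have hip : ∀ {P Q : Poly}, P ∈ box n m → Q ∈ box n m → ip ρ P Q = ip (bernsteinSzego p) P Q :=
    ip_eq_of_kernel_eq hρ (hstable.nondegenerate_bernsteinSzego n m) hker
  have hpbox := kernelPolynomial_mem_box hρ hp hstable
  have hUR := boxUR_le_box n m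
  have hRUR := boxR_le_boxUR n m
  have hle : ominus ρ (boxUR n m) (boxR n m) ≤ ominus ρ (boxU n m) (boxSM n m) := by
    rintro f ⟨hf, hf0⟩
    refine ⟨mem_boxU_of_orthogonal hstable hpbox hf fun Q hQ => ?_,
      fun Q hQ => hf0 Q (boxSM_le_boxR n m hQ)⟩
    rw [← hip (hUR hf) (hUR (hRUR hQ)), hf0 Q hQ]
  refine le_antisymm hle ?_
  rintro f ⟨hf, hf0⟩
  have := finiteDimensional_box n m
  have : FiniteDimensional ℂ (boxR n m) := Submodule.finiteDimensional_of_le (hRUR.trans hUR)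
  -- The inclusion already proved applies to f - v. Hence v lies in both G^U and G^R, so in G^S, to
  -- which f and f - v are both orthogonal; thus v is orthogonal to itself and f = f - v.
  obtain ⟨v, hv, hv0⟩ := exists_projection ρ (boxR n m) (fun P hP => hρ P (hUR (hRUR hP))) f
  have hfUR := boxU_le_boxUR n m hf
  have hu : f - v ∈ ominus ρ (boxUR n m) (boxR n m) :=
    ⟨Submodule.sub_mem _ hfUR (hRUR hv), hv0⟩
  obtain ⟨hu1, hu2⟩ := hle hu
  have hvS : v ∈ boxSM n m := mem_boxSM (by simpa using Submodule.sub_mem _ hf hu1) hv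
  have hvv : ip ρ v v = 0 := by
    have h := hu2 v hvS
    rwa [ip_sub_left, hf0 v hvS, zero_sub, neg_eq_zero] at h
  have hv00 : v = 0 := hρ v (hUR (hRUR hv)) (by simp [pnorm, hvv])
  rwa [hv00, sub_zero] at hu
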